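/- Let $R$ be a finite commutative chain ring with unity, let $\gamma$ be a generator of its maximal ideal, let $e$ be the nilpotency index of $\gamma$, and let $\overline{R}=R/\langle\gamma\rangle$ be the residue field, of order $p^m$ with $p$ prime and $m\ge 1$; write $\overline{\phantom{r}}$ for reduction modulo $\gamma$. Let $\zeta\in R$ have multiplicative order $p^m-1$ and let $\mathcal T=\{0,1,\zeta,\dots,\zeta^{p^m-2}\}$ be the Teichmüller set. Let $\lambda=\alpha+\gamma\beta$ with $0\ne\alpha\in\mathcal T$ and $\beta$ a unit of $R$, and let $n,s\ge 0$ be integers with $\gcd(n,p)=1$. Put $N=np^s$, $R_\lambda=R[x]/\langle x^{N}-\lambda\rangle$, $\overline R_{\lambda}=\overline R[x]/\langle x^{N}-\overline\lambda\rangle$, and let $\mu:R_\lambda\to\overline R_{\lambda}$ be the map reducing coefficients modulo $\gamma$. A $\lambda$-constacyclic code of length $N$ over $R$ is an ideal $\mathcal C$ of $R_\lambda$; for $0\le i\le e-1$ its $i$-th torsion code is $\mathrm{Tor}_i(\mathcal C)=\{\mu(g) : g\in R_\lambda,\ \gamma^i g\in\mathcal C\}$. A polynomial in $R[x]$ is basic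 irreducible if its reduction modulo $\gamma$ is irreducible over $\overline R$. There is $\alpha_0\in\mathcal T$ with $\alpha_0^{p^s}=\alpha$. For every such $\alpha_0$, the polynomial $x^n-\alpha_0$ has a factorization $x^n-\alpha_0=f_1(x)\cdots f_r(x)$ into monic, basic irreducible, pairwise coprime polynomials in $R[x]$, and for every such factorization and every $\lambda$-constacyclic code $\mathcal C$ of length $np^s$ over $R$ the following hold. (a) $\mathcal C=\big\langle \prod_{\ell=1}^r f_\ell(x)^{k_\ell}\big\rangle$ in $R_\lambda$ for some integers $0\le k_\ell\le ep^s$ $(1\le\ell\le r)$. (b) Whenever $\mathcal C=\big\langle \prod_{\ell=1}^r f_\ell(x)^{k_\ell}\big\rangle$ with $0\le k_\ell\le ep^s$ for all $\ell$, then for every $0\le i\le e-1$ $$\mathrm{Tor}_i(\mathcal C)=\Big\langle \prod_{\ell=1}^r \overline{f_\ell(x)}^{\,\tau_\ell(i)}\Big\rangle\quad\text{in }\overline R_{\lambda},\qquad \tau_\ell(i)=\min\{(i+1)p^s,k_\ell\}-\min\{ip^s,k_\ell\}.$$ -/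

import Mathlib

open Polynomial

/-- A finite commutative chain ring: a finite nontrivial commutative ring whose ideals are
linearly ordered by inclusion. -/
structure IsFiniteChainRing (R : Type*) [CommRing R] : Prop where
  finite : Finite R
  nontrivial : Nontrivial R
  chain : ∀ I J : Ideal R, I ≤ J ∨ J ≤ I

/-- The quotient `R / ⟨γ⟩`, the residue field when `γ` generates the maximal ideal. -/
abbrev ResidueRing {R : Type*} [CommRing R] (γ : R) : Type _ :=
  R ⧸ Ideal.span {γ}

/-- The reduction map `r ↦ r + ⟨γ⟩`. -/
abbrev residueMap {R : Type*} [CommRing R] (γ : R) : R →+* ResidueRing γ :=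
  Ideal.Quotient.mk (Ideal.span {γ})

/-- The set `{0, 1, ζ, …, ζ ^ (q - 2)}`; it is the Teichmüller set when `ζ` has multiplicative
order `q - 1`, where `q` is the order of the residue field. -/
def teichmullerSet {R : Type*} [CommRing R] (ζ : R) (q : ℕ) : Set R :=
  {a | a = 0 ∨ ∃ j < q - 1, a = ζ ^ j}

/-- A polynomial over `R` is basic irreducible if its reduction modulo `γ` is irreducible. -/
def IsBasicIrreducible {R : Type*} [CommRing R] (γ : R) (f : R[X]) : Prop :=
  Irreducible (f.map (residueMap γ))

/-- The ring `R[x] / ⟨x ^ N - lam⟩`, whose ideals are the `lam`-constacyclic codes of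
length `N` over `R`. -/
abbrev ConstaRing (R : Type*) [CommRing R] (N : ℕ) (lam : R) : Type _ :=
  R[X] ⧸ Ideal.span {(X ^ N - C lam : R[X])}

/-- The class of a polynomial in `R[x] / ⟨x ^ N - lam⟩`. -/
noncomputable abbrev ConstaRing.mk {R : Type*} [CommRing R] (N : ℕ) (lam : R) : R[X] →+* ConstaRing R N lam :=
  Ideal.Quotient.mk (Ideal.span {(X ^ N - C lam : R[X])})

/-- The map `μ` from `R[x] / ⟨x ^ N - lam⟩` to the corresponding ring over `R / ⟨γ⟩` that reduces the
coefficients modulo `γ`. -/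
noncomputable def reductionMap {R : Type*} [CommRing R] (γ : R) (N : ℕ) (lam : R) :
    ConstaRing R N lam →+* ConstaRing (ResidueRing γ) N (residueMap γ lam) :=
  Ideal.Quotient.lift (Ideal.span {(X ^ N - C lam : R[X])})
    ((ConstaRing.mk N (residueMap γ lam)).comp (Polynomial.mapRingHom (residueMap γ)))
    (by
      intro a ha
      obtain ⟨b, rfl⟩ := Ideal.mem_span_singleton'.mp ha
      rw [RingHom.comp_apply, Ideal.Quotient.eq_zero_iff_mem, map_mul]
      refine Ideal.mul_mem_left _ _ (Ideal.subset_span ?_)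
      simp)

theorem reductionMap_mk {R : Type*} [CommRing R] (γ : R) (N : ℕ) (lam : R) (g : R[X]) :
    reductionMap γ N lam (ConstaRing.mk N lam g) =
      ConstaRing.mk N (residueMap γ lam) (g.map (residueMap γ)) :=
  rfl

/-- The `i`-th torsion code `Tor_i(D) = {μ(g) | γ ^ i * g ∈ D}` of a constacyclic code `D`. -/
def torsionCode {R : Type*} [CommRing R] (γ : R) (N : ℕ) (lam : R)
    (D : Ideal (ConstaRing R N lam)) (i : ℕ) :
    Set (ConstaRing (ResidueRing γ) N (residueMap γ lam)) :=
  {b | ∃ g : ConstaRing R N lam,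
    ConstaRing.mk N lam (C (γ ^ i)) * g ∈ D ∧ reductionMap γ N lam g = b}

/-- `f 0, …, f (r - 1)` are monic, basic irreducible, pairwise coprime polynomials whose product
is `h`. -/
structure IsBasicFactorization {R : Type*} [CommRing R] (γ : R) (h : R[X]) {r : ℕ}
    (f : Fin r → R[X]) : Prop where
  monic : ∀ l, (f l).Monic
  basicIrreducible : ∀ l, IsBasicIrreducible γ (f l)
  coprime : ∀ l l', l ≠ l' → IsCoprime (f l) (f l')
  prod_eq : h = ∏ l, f l

/-! Write `z` for the class of `x^n - α₀` in `R_λ` and `q = p^s`. Since `p ∈ ⟨γ⟩` and `β` is a unit,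
`z^q` is `γ` times a unit (`ConstaRing.mk_pow_eq`), so `z^(eq) = 0`. Each factor `f_l` divides `z`,
hence `γ`, up to a unit, in a power; it therefore generates a maximal ideal with quotient
`R̄[x]/⟨f̄_l⟩`. Pairwise coprime elements generating maximal ideals, with nilpotent product, force
every ideal to be generated by a product of their powers (`exists_eq_span_prod_pow`).

For torsion, `γ^i` is `z^(iq)` up to a unit, so the colon ideal of `C` by `γ^i` has exponents `k_l -
iq`, truncated at 0 (`mul_prod_pow_mem_span_iff`). This needs the powers of `f_l` to decrease
strictly up to `eq`. Reducing modulo `γ` kills `z^q` and caps the exponents at `q`, which gives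
`τ_l(i)`. -/

section CoprimeProducts

/-! ### Ideals generated by powers of coprime elements with nilpotent product -/

variable {A ι : Type*} [CommRing A] [Fintype ι] {F : ι → A} {M : ℕ}

/-- `F l ^ j` divides `0 = ∏ F x ^ M` and is coprime to every factor with `x ≠ l`. -/
theorem pow_dvd_pow_of_prod_pow_eq_zero (hcop : Pairwise (Function.onFun IsCoprime F))
    (hM : (∏ l, F l) ^ M = 0) (l : ι) (j : ℕ) : F l ^ j ∣ F l ^ M := by
  classical
  have hG : IsCoprime (F l ^ j) (∏ x ∈ Finset.univ.erase l, F x ^ M) :=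
    IsCoprime.prod_right fun x hx => (hcop (Finset.ne_of_mem_erase hx).symm).pow
  refine hG.dvd_of_dvd_mul_right ?_
  rw [Finset.mul_prod_erase Finset.univ (fun x => F x ^ M) (Finset.mem_univ l),
    Finset.prod_pow, hM]
  exact dvd_zero _

theorem prod_pow_dvd_prod_pow_min (hcop : Pairwise (Function.onFun IsCoprime F))
    (hM : (∏ l, F l) ^ M = 0) (k : ι → ℕ) : ∏ l, F l ^ k l ∣ ∏ l, F l ^ min M (k l) := by
  refine Finset.prod_dvd_prod_of_dvd _ _ fun l _ => ?_
  rcases le_total M (k l) with h | h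
  · rw [min_eq_left h]
    exact pow_dvd_pow_of_prod_pow_eq_zero hcop hM l _
  · rw [min_eq_right h]

theorem span_prod_pow_min (hcop : Pairwise (Function.onFun IsCoprime F))
    (hM : (∏ l, F l) ^ M = 0) (k : ι → ℕ) :
    Ideal.span {∏ l, F l ^ min M (k l)} = Ideal.span {∏ l, F l ^ k l} := by
  refine le_antisymm ?_ ?_
  · exact Ideal.span_singleton_le_span_singleton.2 (prod_pow_dvd_prod_pow_min hcop hM k)
  · exact Ideal.span_singleton_le_span_singleton.2
      (Finset.prod_dvd_prod_of_dvd _ _ fun l _ => pow_dvd_pow _ (min_le_right _ _))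

/-- Take `k l ≤ M` largest with `D ≤ ⟨F l ^ k l⟩`; coprimality gives `D ≤ ⟨P⟩`, where `P` is the
product. If `P ∉ D`, the colon ideal `J = (D : P)` lies in some maximal ideal, which must be one of
the `⟨F l⟩`, and either case for `k l` is contradictory. -/
theorem exists_eq_span_prod_pow (hcop : Pairwise (Function.onFun IsCoprime F))
    (hM : (∏ l, F l) ^ M = 0) (hmax : ∀ l, (Ideal.span {F l}).IsMaximal) (D : Ideal A) :
    ∃ k : ι → ℕ, (∀ l, k l ≤ M) ∧ D = Ideal.span {∏ l, F l ^ k l} := by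
  classical
  let S : ι → Set ℕ := fun l => {j | j ≤ M ∧ D ≤ Ideal.span {F l ^ j}}
  have hS : ∀ l, ∃ j ∈ S l, ∀ i ∈ S l, i ≤ j := fun l => by
    have hfin : (S l).Finite := (Set.finite_Iic M).subset fun j hj => hj.1
    obtain ⟨j, hj, hmx⟩ := hfin.exists_maximalFor id _ ⟨0, by simp [S]⟩
    exact ⟨j, hj, fun i hi => (le_total i j).elim id fun h => hmx hi h⟩
  choose k hk hkmax using hS
  have hDle : D ≤ Ideal.span {∏ l, F l ^ k l} := fun x hx => by
    rw [Ideal.mem_span_singleton]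
    refine Finset.prod_dvd_of_coprime (fun i _ j _ hij => (hcop hij).pow) fun l _ => ?_
    exact Ideal.mem_span_singleton.1 ((hk l).2 hx)
  refine ⟨k, fun l => (hk l).1, le_antisymm hDle ?_⟩
  rw [Ideal.span_singleton_le_iff_mem]
  set P := ∏ l, F l ^ k l with hP
  let J : Ideal A := Submodule.comap (LinearMap.mulRight A P) D
  have hJ : ∀ x, x ∈ J ↔ x * P ∈ D := fun x => Iff.rfl
  by_contra hPD
  have hJtop : J ≠ ⊤ := fun h => hPD (by simpa [h] using (hJ 1).1 (h ▸ trivial))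
  obtain ⟨I, hI, hJI⟩ := Ideal.exists_le_maximal J hJtop
  have hprod : (∏ l, F l) ∈ I := hI.isPrime.mem_of_pow_mem M (hM ▸ I.zero_mem)
  obtain ⟨l, -, hl⟩ := (Ideal.IsPrime.prod_mem_iff (hp := hI.isPrime)).1 hprod
  have hIl : Ideal.span {F l} = I :=
    (hmax l).eq_of_le hI.ne_top ((Ideal.span_singleton_le_iff_mem _).2 hl)
  rcases (hk l).1.lt_or_eq with hlt | heq
  -- Elements of `D` are `c * P` with `c ∈ J ≤ ⟨F l⟩`, so they gain one more factor `F l`.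
  · have : k l + 1 ∈ S l := by
      refine ⟨hlt, fun x hx => ?_⟩
      obtain ⟨c, rfl⟩ := Ideal.mem_span_singleton'.1 (hDle hx)
      have hc : F l ∣ c := by
        rw [← Ideal.mem_span_singleton, hIl]
        exact hJI hx
      rw [Ideal.mem_span_singleton, pow_succ']
      exact mul_dvd_mul hc (Finset.dvd_prod_of_mem (fun l => F l ^ k l) (Finset.mem_univ l))
    have := hkmax l _ this
    omega
  -- When `k l = M`, the other factors to the power `M` kill `P`, yet are coprime to `F l`.
  · have hG : (∏ x ∈ Finset.univ.erase l, F x ^ M) ∈ J := by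
      rw [hJ]
      have hz : (∏ x ∈ Finset.univ.erase l, F x ^ M) * P = 0 := by
        rw [hP, ← Finset.mul_prod_erase Finset.univ (fun l => F l ^ k l) (Finset.mem_univ l),
          ← mul_assoc, heq, mul_comm _ (F l ^ M),
          Finset.mul_prod_erase Finset.univ (fun x => F x ^ M) (Finset.mem_univ l),
          Finset.prod_pow, hM, zero_mul]
      rw [hz]
      exact D.zero_mem
    have hcopG : IsCoprime (F l) (∏ x ∈ Finset.univ.erase l, F x ^ M) :=
      IsCoprime.prod_right fun x hx => (hcop (Finset.ne_of_mem_erase hx).symm).pow_right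
    obtain ⟨u, v, huv⟩ := hcopG
    apply hI.ne_top
    rw [Ideal.eq_top_iff_one, ← huv]
    exact I.add_mem (I.mul_mem_left _ hl) (I.mul_mem_left _ (hJI hG))

theorem mul_prod_pow_mem_span_iff (hcop : Pairwise (Function.onFun IsCoprime F))
    (hM : (∏ l, F l) ^ M = 0) (hmax : ∀ l, (Ideal.span {F l}).IsMaximal)
    (hstrict : ∀ l, ¬ F l ^ M ∣ F l ^ (M - 1)) {k : ι → ℕ} (hk : ∀ l, k l ≤ M) (a : ι → ℕ)
    (c : A) : c * ∏ l, F l ^ a l ∈ Ideal.span {∏ l, F l ^ k l} ↔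
      c ∈ Ideal.span {∏ l, F l ^ (k l - a l)} := by
  classical
  simp only [Ideal.mem_span_singleton]
  constructor
  · intro h
    -- Up to mutual divisibility `c` is itself a product `∏ F l ^ b l`, so only exponents need
    -- comparing.
    obtain ⟨b, -, hb⟩ := exists_eq_span_prod_pow hcop hM hmax (Ideal.span {c})
    have hbc : (∏ l, F l ^ b l) ∣ c := by
      rw [← Ideal.mem_span_singleton, ← hb]
      exact Ideal.mem_span_singleton_self c
    have hcb : c ∣ ∏ l, F l ^ b l := by
      rw [← Ideal.mem_span_singleton, hb]
      exact Ideal.mem_span_singleton_self _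
    refine (Finset.prod_dvd_prod_of_dvd _ _ fun l _ => pow_dvd_pow _ ?_).trans hbc
    rw [tsub_le_iff_right]
    by_contra hlt
    rw [not_le] at hlt
    have h1 : F l ^ k l ∣ ∏ x, F x ^ (b x + a x) := by
      refine ((Finset.dvd_prod_of_mem (fun x => F x ^ k x) (Finset.mem_univ l)).trans h).trans ?_
      simp only [pow_add, Finset.prod_mul_distrib]
      exact mul_dvd_mul_right hcb _
    rw [← Finset.mul_prod_erase Finset.univ (fun x => F x ^ (b x + a x)) (Finset.mem_univ l)] at h1
    have h2 : F l ^ k l ∣ F l ^ (b l + a l) :=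
      (IsCoprime.prod_right fun x hx =>
        (hcop (Finset.ne_of_mem_erase hx).symm).pow).dvd_of_dvd_mul_right h1
    apply hstrict l
    -- If `b l + a l < k l`, this padding turns the divisibility into `F l ^ M ∣ F l ^ (M - 1)`.
    have h3 := mul_dvd_mul_right h2 (F l ^ (M - 1 - (b l + a l)))
    rw [← pow_add, ← pow_add] at h3
    have := hk l
    rw [show b l + a l + (M - 1 - (b l + a l)) = M - 1 by omega] at h3
    exact (pow_dvd_pow _ (by omega)).trans h3
  · rintro ⟨d, rfl⟩
    rw [mul_right_comm, ← Finset.prod_mul_distrib]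
    refine Dvd.dvd.mul_right (Finset.prod_dvd_prod_of_dvd _ _ fun l _ => ?_) _
    rw [← pow_add]
    exact pow_dvd_pow _ (by omega)

end CoprimeProducts

/-! ### Hensel lifting along a nilpotent `γ` -/

section NilpotentLifting

variable {R : Type*} [CommRing R] {γ : R}

theorem map_residueMap_eq_zero_iff {q : R[X]} : q.map (residueMap γ) = 0 ↔ C γ ∣ q := by
  rw [C_dvd_iff_dvd_coeff, Polynomial.ext_iff]
  simp [Ideal.Quotient.eq_zero_iff_mem, Ideal.mem_span_singleton]

theorem map_residueMap_eq_iff {f g : R[X]} :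
    f.map (residueMap γ) = g.map (residueMap γ) ↔ C γ ∣ f - g := by
  rw [← map_residueMap_eq_zero_iff, Polynomial.map_sub, sub_eq_zero]

theorem map_residueMap_surjective : Function.Surjective (map (residueMap γ)) :=
  map_surjective _ Ideal.Quotient.mk_surjective

theorem isCoprime_of_isCoprime_map (hγ : IsNilpotent γ) {f g : R[X]}
    (h : IsCoprime (f.map (residueMap γ)) (g.map (residueMap γ))) : IsCoprime f g := by
  obtain ⟨u', v', huv⟩ := h
  obtain ⟨u, rfl⟩ := map_residueMap_surjective u'
  obtain ⟨v, rfl⟩ := map_residueMap_surjective v'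
  have h1 : C γ ∣ u * f + v * g - 1 := by
    rw [← map_residueMap_eq_iff]
    simpa using huv
  obtain ⟨w, hw⟩ := h1
  have hunit : IsUnit (C γ * w + 1) :=
    IsNilpotent.isUnit_add_one ((Commute.all _ _).isNilpotent_mul_right (hγ.map C))
  obtain ⟨t, ht⟩ := hunit.exists_left_inv
  refine ⟨t * u, t * v, ?_⟩
  rw [← ht]
  linear_combination t * hw

theorem exists_mul_eq_of_isCoprime (hγ : IsNilpotent γ) {f g h : R[X]} (hg : g.Monic)
    (hcop : IsCoprime g h) (hf : C γ ∣ f - g * h) :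
    ∃ g' h' : R[X], g'.Monic ∧ C γ ∣ g' - g ∧ C γ ∣ h' - h ∧ f = g' * h' := by
  nontriviality R
  have key : ∀ j : ℕ, ∃ g' h' : R[X], g'.Monic ∧ C γ ∣ g' - g ∧ C γ ∣ h' - h ∧
      C γ ^ (j + 1) ∣ f - g' * h' := by
    intro j
    induction j with
    | zero => exact ⟨g, h, hg, by simp, by simp, by simpa using hf⟩
    | succ j ih =>
      obtain ⟨g', h', hg', hgg, hhh, d, hd⟩ := ih
      have hcop' : IsCoprime g' h' := by
        refine isCoprime_of_isCoprime_map hγ ?_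
        rw [map_residueMap_eq_iff.2 hgg, map_residueMap_eq_iff.2 hhh]
        exact hcop.map (mapRingHom (residueMap γ))
      obtain ⟨u, v, huv⟩ := hcop'
      -- Correcting `g'` only by the remainder `r` keeps it monic of the same degree; the quotient
      -- is absorbed into `h'`.
      have hdiv := modByMonic_add_div (v * d) g'
      set r := (v * d) %ₘ g'
      set q := (v * d) /ₘ g'
      have hdeg : (C γ ^ (j + 1) * r).degree < g'.degree := by
        rw [← C_pow, ← smul_eq_C_mul]
        exact (degree_smul_le _ _).trans_lt (degree_modByMonic_lt _ hg')
      refine ⟨g' + C γ ^ (j + 1) * r, h' + C γ ^ (j + 1) * (u * d + q * h'),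
        hg'.add_of_left hdeg, ?_, ?_, ?_⟩
      · rw [add_sub_right_comm]
        exact dvd_add hgg (Dvd.dvd.mul_right (dvd_pow_self _ (by omega)) _)
      · rw [add_sub_right_comm]
        exact dvd_add hhh (Dvd.dvd.mul_right (dvd_pow_self _ (by omega)) _)
      · refine ⟨-(C γ ^ j * r * (u * d + q * h')), ?_⟩
        linear_combination hd - C γ ^ (j + 1) * d * huv - C γ ^ (j + 1) * h' * hdiv
  obtain ⟨e, he⟩ := hγ
  obtain ⟨g', h', hg', hgg, hhh, hfg⟩ := key e
  refine ⟨g', h', hg', hgg, hhh, ?_⟩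
  rw [pow_succ, ← C_pow, he] at hfg
  simpa [sub_eq_zero] using hfg

theorem exists_monic_map_eq {g : (ResidueRing γ)[X]} (hg : g.Monic) :
    ∃ G : R[X], G.Monic ∧ G.map (residueMap γ) = g := by
  obtain ⟨G, hG, -, hm⟩ := lifts_and_natDegree_eq_and_monic
    ((mem_lifts g).2 (map_residueMap_surjective g)) hg
  exact ⟨G, hm, hG⟩

theorem exists_prod_eq_of_map_eq_prod [Nontrivial (ResidueRing γ)] (hγ : IsNilpotent γ) {r : ℕ}
    (g : Fin r → (ResidueRing γ)[X])
    (hg : ∀ l, (g l).Monic) (hcop : ∀ l l', l ≠ l' → IsCoprime (g l) (g l')) {f : R[X]}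
    (hf : f.Monic) (hfg : f.map (residueMap γ) = ∏ l, g l) :
    ∃ G : Fin r → R[X], (∀ l, (G l).Monic) ∧ (∀ l, (G l).map (residueMap γ) = g l) ∧
      f = ∏ l, G l := by
  induction r generalizing f with
  | zero =>
    refine ⟨fun l => l.elim0, fun l => l.elim0, fun l => l.elim0, ?_⟩
    simp only [Finset.univ_eq_empty, Finset.prod_empty] at hfg ⊢
    rw [← hf.natDegree_eq_zero, ← hf.natDegree_map (residueMap γ), hfg, natDegree_one]
  | succ r ih =>
    rw [Fin.prod_univ_succ] at hfg
    obtain ⟨G, hG, hGg⟩ := exists_monic_map_eq (hg 0)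
    obtain ⟨H, hH⟩ := map_residueMap_surjective (∏ l : Fin r, g l.succ)
    have hGH : IsCoprime G H := by
      refine isCoprime_of_isCoprime_map hγ ?_
      rw [hGg, hH]
      exact IsCoprime.prod_right fun l _ => hcop _ _ (Fin.succ_ne_zero l).symm
    obtain ⟨G', H', hG', hGG, hHH, hf'⟩ := exists_mul_eq_of_isCoprime hγ (f := f) hG hGH (by
      rw [← map_residueMap_eq_iff, hfg, Polynomial.map_mul, hGg, hH])
    rw [← map_residueMap_eq_iff] at hGG hHH
    obtain ⟨Gs, hGs, hGsg, hprod⟩ := ih (fun l => g l.succ) (fun l => hg _)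
      (fun l l' h => hcop _ _ (by simpa using h)) (f := H')
      (hG'.of_mul_monic_left (hf' ▸ hf)) (hHH.trans hH)
    refine ⟨Fin.cons G' Gs, Fin.cases hG' hGs, Fin.cases (hGG.trans hGg) hGsg, ?_⟩
    rw [Fin.prod_univ_succ, hf', hprod]
    simp

theorem exists_fin_prod_irreducible {K : Type*} [Field K] {h : K[X]} (hm : h.Monic)
    (hs : h.Separable) : ∃ (r : ℕ) (g : Fin r → K[X]), (∀ l, (g l).Monic) ∧
      (∀ l, Irreducible (g l)) ∧ (∀ l l', l ≠ l' → IsCoprime (g l) (g l')) ∧ h = ∏ l, g l := by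
  classical
  let L := (UniqueFactorizationMonoid.normalizedFactors h).toList
  have hL : ∀ x ∈ L, x ∈ UniqueFactorizationMonoid.normalizedFactors h := fun x hx =>
    Multiset.mem_toList.1 hx
  have hirr : ∀ x ∈ L, Irreducible x := fun x hx =>
    UniqueFactorizationMonoid.irreducible_of_normalized_factor _ (hL x hx)
  have hmon : ∀ x ∈ L, x.Monic := fun x hx => by
    rw [← UniqueFactorizationMonoid.normalize_normalized_factor _ (hL x hx)]
    exact monic_normalize (hirr x hx).ne_zero
  have hnd : L.Nodup := by
    rw [← Multiset.coe_nodup, Multiset.coe_toList,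
      ← UniqueFactorizationMonoid.squarefree_iff_nodup_normalizedFactors hm.ne_zero]
    exact hs.squarefree
  refine ⟨L.length, L.get, fun l => hmon _ (L.get_mem l), fun l => hirr _ (L.get_mem l), ?_, ?_⟩
  · intro l l' hl
    rw [(hirr _ (L.get_mem l)).coprime_iff_not_dvd]
    intro hdvd
    refine hl (hnd.injective_get ?_)
    exact eq_of_monic_of_associated (hmon _ (L.get_mem l)) (hmon _ (L.get_mem l'))
      ((hirr _ (L.get_mem l)).associated_of_dvd (hirr _ (L.get_mem l')) hdvd)
  · have h1 : ∏ l, L.get l = L.prod := by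
      rw [← List.prod_ofFn, List.ofFn_get]
    rw [h1, Multiset.prod_toList,
      UniqueFactorizationMonoid.prod_normalizedFactors_eq hm.ne_zero, hm.normalize_eq_self]

end NilpotentLifting

/-! ### The residue field, Teichmüller roots and the factorization of `x^n - a` -/

section ChainRing

variable {R : Type*} [CommRing R] {γ : R}

theorem IsFiniteChainRing.isNilpotent (hR : IsFiniteChainRing R)
    (hγ : (Ideal.span {γ} : Ideal R).IsMaximal) : IsNilpotent γ := by
  have := hR.finite
  rw [← mem_nilradical, nilradical_eq_sInf, Ideal.mem_sInf]
  intro P hP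
  have hPmax : P.IsMaximal := Ideal.IsPrime.isMaximal' (hI := hP)
  have : P = Ideal.span {γ} := by
    rcases hR.chain P (Ideal.span {γ}) with h | h
    · exact hPmax.eq_of_le hγ.ne_top h
    · exact (hγ.eq_of_le hPmax.ne_top h).symm
  rw [this]
  exact Ideal.mem_span_singleton_self γ

theorem natCast_residueRing_eq_zero (hγ : (Ideal.span {γ} : Ideal R).IsMaximal) {p m : ℕ}
    (hcard : Nat.card (ResidueRing γ) = p ^ m) : (p : ResidueRing γ) = 0 := by
  have hK : IsDomain (ResidueRing γ) :=
    (Ideal.Quotient.isDomain_iff_prime _).2 hγ.isPrime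
  have h : ((p ^ m : ℕ) : ResidueRing γ) = 0 := by
    rw [← hcard, ← nsmul_one, card_nsmul_eq_zero']
  rw [Nat.cast_pow] at h
  exact eq_zero_of_pow_eq_zero h

theorem exists_natCast_eq_mul (hγ : (Ideal.span {γ} : Ideal R).IsMaximal) {p m : ℕ}
    (hcard : Nat.card (ResidueRing γ) = p ^ m) : ∃ t, (p : R) = γ * t := by
  have h := natCast_residueRing_eq_zero hγ hcard
  rw [← map_natCast (residueMap γ), Ideal.Quotient.eq_zero_iff_mem, Ideal.mem_span_singleton] at h
  exact h

/-- Raising to the power `q^m` fixes powers of `ζ`, so `α ^ q^(ms - s)` is a `q^s`-th root of `α`.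
-/
theorem exists_teichmuller_root {ζ : R} {q m : ℕ} (hq : 1 < q ^ m)
    (hζ : ζ ^ (q ^ m - 1) = 1) (s : ℕ) {α : R} (hα : α ∈ teichmullerSet ζ (q ^ m)) (hα0 : α ≠ 0)
    (hm : 0 < m) : ∃ α₀ ∈ teichmullerSet ζ (q ^ m), α₀ ^ q ^ s = α := by
  obtain ⟨j, -, rfl⟩ := hα.resolve_left hα0
  refine ⟨(ζ ^ j) ^ q ^ (m * s - s), Or.inr ⟨j * q ^ (m * s - s) % (q ^ m - 1),
    Nat.mod_lt _ (by omega), ?_⟩, ?_⟩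
  · rw [← pow_mul, ← Nat.mod_add_div (j * q ^ (m * s - s)) (q ^ m - 1), pow_add, pow_mul, hζ,
      one_pow, mul_one]
    simp
  · have h1 : ∀ i, (ζ ^ j) ^ (q ^ m) ^ i = ζ ^ j := fun i => by
      induction i with
      | zero => simp
      | succ i ih =>
        rw [pow_succ, pow_mul, ih, ← Nat.sub_add_cancel hq.le, pow_succ, ← pow_mul, mul_comm j,
          pow_mul, hζ]
        simp
    rw [← pow_mul, ← pow_add, Nat.sub_add_cancel (Nat.le_mul_of_pos_left s hm), pow_mul]
    exact h1 s

theorem isUnit_of_mem_teichmullerSet {ζ : R} {q : ℕ} (hq : 1 < q) (hζ : ζ ^ (q - 1) = 1)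
    {a : R} (ha : a ∈ teichmullerSet ζ q) (ha0 : a ≠ 0) : IsUnit a := by
  obtain ⟨j, -, rfl⟩ := ha.resolve_left ha0
  exact (IsUnit.of_pow_eq_one hζ (by omega)).pow j

/-- Modulo `γ` the polynomial is separable, because `n` is prime to `p`; its irreducible factors
lift. -/
theorem exists_isBasicFactorization (hγ : (Ideal.span {γ} : Ideal R).IsMaximal)
    (hnil : IsNilpotent γ) {p m n : ℕ} (hp : p.Prime)
    (hcard : Nat.card (ResidueRing γ) = p ^ m) (hn : n.Coprime p) {a : R} (ha : IsUnit a) :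
    ∃ (r : ℕ) (f : Fin r → R[X]), IsBasicFactorization γ (X ^ n - C a) f := by
  let : Field (ResidueRing γ) := Ideal.Quotient.field _
  have hn0 : n ≠ 0 := by
    rintro rfl
    exact hp.one_lt.ne' (by simpa using hn)
  have hnK : (n : ResidueRing γ) ≠ 0 := by
    have h := hn.cast (R := ResidueRing γ)
    rw [natCast_residueRing_eq_zero hγ hcard, isCoprime_zero_right] at h
    exact h.ne_zero
  have hmap : (X ^ n - C a : R[X]).map (residueMap γ) = X ^ n - C (residueMap γ a) := by simp
  have hsep : ((X ^ n - C a : R[X]).map (residueMap γ)).Separable := by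
    rw [hmap]
    exact separable_X_pow_sub_C _ hnK (ha.map (residueMap γ)).ne_zero
  have hmonic : (X ^ n - C a : R[X]).Monic := monic_X_pow_sub_C a hn0
  obtain ⟨r, g, hg, hirr, hcop, hprod⟩ := exists_fin_prod_irreducible (hmonic.map _) hsep
  obtain ⟨G, hG, hGg, hGprod⟩ := exists_prod_eq_of_map_eq_prod hnil g hg hcop hmonic hprod
  refine ⟨r, G, hG, fun l => ?_, fun l l' h => ?_, hGprod⟩
  · rw [IsBasicIrreducible, hGg]
    exact hirr l
  · refine isCoprime_of_isCoprime_map hnil ?_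
    rw [hGg, hGg]
    exact hcop l l' h

end ChainRing

/-! ### Structure of `R_λ` -/

section ConstaRing

variable {R : Type*} [CommRing R] {γ α₀ β lam : R} {p n s : ℕ}

/-- Expand `((x^n - α₀) + α₀)^(p^s)`: the cross terms are divisible by `p (x^n - α₀)`, and `γ ∣ p`.
-/
theorem exists_X_pow_sub_C_eq (hp : p.Prime) (hpγ : ∃ t, (p : R) = γ * t)
    (hlam : lam = α₀ ^ p ^ s + γ * β) :
    ∃ w : R[X], X ^ (n * p ^ s) - C lam =
      (X ^ n - C α₀) ^ p ^ s - C γ * (C β - (X ^ n - C α₀) * w) := by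
  obtain ⟨t, ht⟩ := hpγ
  obtain ⟨r, hr⟩ := exists_add_pow_prime_pow_eq hp (X ^ n - C α₀) (C α₀) s
  rw [sub_add_cancel, ← pow_mul] at hr
  refine ⟨C t * C α₀ * r, ?_⟩
  have hpC : (p : R[X]) = C γ * C t := by rw [← C_mul, ← ht, C_eq_natCast]
  rw [hr, hlam, hpC]
  simp only [map_add, map_mul, map_pow]
  ring

theorem ConstaRing.mk_pow_eq (hp : p.Prime) (hpγ : ∃ t, (p : R) = γ * t) (hnil : IsNilpotent γ)
    (hβ : IsUnit β) (hlam : lam = α₀ ^ p ^ s + γ * β) :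
    ∃ u : (ConstaRing R (n * p ^ s) lam)ˣ,
      ConstaRing.mk (n * p ^ s) lam (X ^ n - C α₀) ^ p ^ s =
        ConstaRing.mk (n * p ^ s) lam (C γ) * u := by
  obtain ⟨w, hw⟩ := exists_X_pow_sub_C_eq (n := n) hp hpγ hlam
  set φ := ConstaRing.mk (n * p ^ s) lam
  have h0 : φ (X ^ (n * p ^ s) - C lam) = 0 :=
    Ideal.Quotient.eq_zero_iff_mem.2 (Ideal.mem_span_singleton_self _)
  replace h0 := (congrArg φ hw).symm.trans h0
  rw [map_sub, map_pow, map_mul, sub_eq_zero] at h0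
  have hz : IsNilpotent (φ (X ^ n - C α₀)) := by
    have h1 : IsNilpotent (φ (X ^ n - C α₀) ^ p ^ s) := by
      rw [h0]
      exact (Commute.all _ _).isNilpotent_mul_right ((hnil.map C).map φ)
    obtain ⟨k, hk⟩ := h1
    exact ⟨p ^ s * k, by rw [pow_mul, hk]⟩
  -- A unit `β` minus a nilpotent.
  have hu : IsUnit (φ (C β - (X ^ n - C α₀) * w)) := by
    rw [map_sub, map_mul, sub_eq_add_neg (φ (C β))]
    exact IsNilpotent.isUnit_add_left_of_commute
      ((Commute.all _ _).isNilpotent_mul_right hz).neg ((hβ.map C).map φ) (Commute.all _ _)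
  exact ⟨hu.unit, h0⟩

theorem ConstaRing.isMaximal_span_mk (hγ : (Ideal.span {γ} : Ideal R).IsMaximal) (hp : p.Prime)
    (hpγ : ∃ t, (p : R) = γ * t) (hnil : IsNilpotent γ)
    (hβ : IsUnit β) (hlam : lam = α₀ ^ p ^ s + γ * β) {f : R[X]} (hf : IsBasicIrreducible γ f)
    (hdvd : f ∣ X ^ n - C α₀) :
    (Ideal.span {ConstaRing.mk (n * p ^ s) lam f}).IsMaximal := by
  let : Field (ResidueRing γ) := Ideal.Quotient.field _
  have hps : p ^ s ≠ 0 := (pow_pos hp.pos s).ne'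
  set φ := ConstaRing.mk (n * p ^ s) lam
  have hmaxK : (Ideal.span {f.map (residueMap γ)}).IsMaximal :=
    PrincipalIdealRing.isMaximal_of_irreducible hf
  set I := (Ideal.span {f.map (residueMap γ)}).comap (mapRingHom (residueMap γ)) with hI
  have hImax : I.IsMaximal :=
    Ideal.comap_isMaximal_of_surjective _ map_residueMap_surjective
  have hmem : ∀ g : R[X], g ∈ I ↔ f.map (residueMap γ) ∣ g.map (residueMap γ) := fun g => by
    rw [hI, Ideal.mem_comap, Ideal.mem_span_singleton, coe_mapRingHom]
  have hfγ : φ f ∣ φ (C γ) := by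
    obtain ⟨u, hu⟩ := ConstaRing.mk_pow_eq (n := n) hp hpγ hnil hβ hlam
    rw [← u.dvd_mul_right, ← hu]
    exact dvd_pow (map_dvd φ hdvd) hps
  have hspan : Ideal.span {φ f} = I.map φ := by
    refine le_antisymm ?_ ?_
    · rw [Ideal.span_singleton_le_iff_mem]
      exact Ideal.mem_map_of_mem _ ((hmem f).2 dvd_rfl)
    · rw [Ideal.map_le_iff_le_comap]
      intro g hg
      obtain ⟨h', hh⟩ := (hmem g).1 hg
      obtain ⟨h, rfl⟩ := map_residueMap_surjective h'
      rw [← Polynomial.map_mul, map_residueMap_eq_iff] at hh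
      rw [Ideal.mem_comap, Ideal.mem_span_singleton, ← sub_add_cancel g (f * h), map_add, map_mul]
      exact dvd_add (hfγ.trans (map_dvd φ hh)) (dvd_mul_right _ _)
  have hker : RingHom.ker φ ≤ I := by
    rw [Ideal.mk_ker, Ideal.span_singleton_le_iff_mem, hmem]
    obtain ⟨w, hw⟩ := exists_X_pow_sub_C_eq (n := n) hp hpγ hlam
    rw [hw, Polynomial.map_sub, Polynomial.map_mul, map_residueMap_eq_zero_iff.2 dvd_rfl, zero_mul,
      sub_zero, Polynomial.map_pow]
    exact dvd_pow (map_dvd (mapRingHom (residueMap γ)) hdvd) hps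
  rw [hspan]
  exact Ideal.IsMaximal.map_of_surjective_of_ker_le Ideal.Quotient.mk_surjective hker

theorem ConstaRing.mk_C_mul_ne_zero {N : ℕ} {c : R} (hc : c ≠ 0) (hN : 0 < N) {g : R[X]}
    (hg : g.Monic) (hdeg : g.natDegree < N) :
    ConstaRing.mk N lam (C c * g) ≠ 0 := by
  nontriviality R
  rw [Ne, Ideal.Quotient.eq_zero_iff_mem, Ideal.mem_span_singleton]
  refine (monic_X_pow_sub_C lam hN.ne').not_dvd_of_degree_lt ?_ ?_
  · intro h
    have := congrArg (fun q => q.coeff g.natDegree) h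
    simp [hg.coeff_natDegree, hc] at this
  · rw [degree_X_pow_sub_C hN, ← smul_eq_C_mul]
    refine (degree_smul_le _ _).trans_lt ?_
    rw [degree_eq_natDegree hg.ne_zero]
    exact_mod_cast hdeg

/-- Multiplying by `g ^ (e p^s)` would give `γ^(e-1) f^(p^s-1) g^(p^s) = 0` up to a unit, but this
representative is nonzero of degree below `n p^s`. -/
theorem ConstaRing.not_pow_dvd_pow_pred (hp : p.Prime)
    (hpγ : ∃ t, (p : R) = γ * t) (hn : 0 < n)
    (hβ : IsUnit β) (hlam : lam = α₀ ^ p ^ s + γ * β) {e : ℕ} (he : 0 < e) (hγe : γ ^ e = 0)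
    (hγe' : γ ^ (e - 1) ≠ 0) {f g : R[X]} (hf : f.Monic) (hg : g.Monic)
    (hfdeg : 0 < f.natDegree) (hfg : X ^ n - C α₀ = f * g) :
    ¬ ConstaRing.mk (n * p ^ s) lam f ^ (e * p ^ s) ∣
      ConstaRing.mk (n * p ^ s) lam f ^ (e * p ^ s - 1) := by
  have : Nontrivial R := nontrivial_of_ne _ _ hγe'
  obtain ⟨u, hu⟩ := ConstaRing.mk_pow_eq (n := n) hp hpγ ⟨e, hγe⟩ hβ hlam
  have hps : 0 < p ^ s := pow_pos hp.pos s
  have hne := ConstaRing.mk_C_mul_ne_zero (lam := lam) (N := n * p ^ s) hγe' (by positivity)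
    (g := f ^ (p ^ s - 1) * g ^ p ^ s) ((hf.pow _).mul (hg.pow _)) (by
      rw [(hf.pow _).natDegree_mul (hg.pow _), hf.natDegree_pow, hg.natDegree_pow]
      have h1 : n = f.natDegree + g.natDegree := by
        rw [← hf.natDegree_mul hg, ← hfg, natDegree_X_pow_sub_C]
      rw [h1]
      obtain ⟨k, hk⟩ := Nat.exists_eq_succ_of_ne_zero hps.ne'
      rw [hk]
      simp only [Nat.succ_sub_one, Nat.succ_eq_add_one]
      nlinarith)
  intro hdvd
  set φ := ConstaRing.mk (n * p ^ s) lam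
  rw [hfg, map_mul] at hu
  have hexp : e * p ^ s - 1 = p ^ s * (e - 1) + (p ^ s - 1) := by
    obtain ⟨k, rfl⟩ := Nat.exists_eq_succ_of_ne_zero he.ne'
    simp only [Nat.succ_eq_add_one, Nat.add_sub_cancel]
    rw [add_mul, one_mul, mul_comm k]
    omega
  have hexp' : e * p ^ s = p ^ s * (e - 1) + p ^ s := by
    obtain ⟨k, rfl⟩ := Nat.exists_eq_succ_of_ne_zero he.ne'
    simp only [Nat.succ_eq_add_one, Nat.add_sub_cancel]
    ring
  have h1 : φ f ^ (e * p ^ s - 1) * φ g ^ (e * p ^ s) = 0 := by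
    refine zero_dvd_iff.1 ?_
    have h2 := mul_dvd_mul_right hdvd (φ g ^ (e * p ^ s))
    rwa [← mul_pow, mul_comm e, pow_mul (φ f * φ g), hu, mul_pow, ← map_pow, ← C_pow, hγe, C_0,
      map_zero, zero_mul, mul_comm (p ^ s)] at h2
  refine hne ?_
  have h3 : φ f ^ (e * p ^ s - 1) * φ g ^ (e * p ^ s) =
      φ (C (γ ^ (e - 1)) * (f ^ (p ^ s - 1) * g ^ p ^ s)) * (u ^ (e - 1) : (ConstaRing R (n * p ^ s) lam)ˣ) := by
    rw [hexp, hexp', pow_add, pow_add, mul_mul_mul_comm, ← mul_pow, pow_mul (φ f * φ g), hu]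
    simp only [map_mul, map_pow, Units.val_pow_eq_pow_val, mul_pow]
    ring
  rw [h3] at h1
  exact (Units.mul_left_eq_zero _).1 h1

end ConstaRing

/-! ### Torsion codes as reductions of colon ideals -/

section TorsionCode

variable {R : Type*} [CommRing R] {γ lam : R} {N q : ℕ}

theorem reductionMap_surjective : Function.Surjective (reductionMap γ N lam) := by
  intro b
  obtain ⟨g', rfl⟩ := Ideal.Quotient.mk_surjective b
  obtain ⟨g, rfl⟩ := map_residueMap_surjective g'
  exact ⟨ConstaRing.mk N lam g, reductionMap_mk γ N lam g⟩

theorem reductionMap_mk_C_self : reductionMap γ N lam (ConstaRing.mk N lam (C γ)) = 0 := by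
  rw [reductionMap_mk, map_residueMap_eq_zero_iff.2 dvd_rfl, map_zero]

theorem torsionCode_eq_of_mul_mem_iff {D : Ideal (ConstaRing R N lam)} {i : ℕ} {P : R[X]}
    (h : ∀ g, ConstaRing.mk N lam (C (γ ^ i)) * g ∈ D ↔
      g ∈ Ideal.span {ConstaRing.mk N lam P}) :
    torsionCode γ N lam D i =
      (Ideal.span {ConstaRing.mk N (residueMap γ lam) (P.map (residueMap γ))} :
        Set (ConstaRing (ResidueRing γ) N (residueMap γ lam))) := by
  have hmap : (Ideal.span {ConstaRing.mk N lam P}).map (reductionMap γ N lam) =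
      Ideal.span {ConstaRing.mk N (residueMap γ lam) (P.map (residueMap γ))} :=
    (Ideal.map_span _ _).trans (congrArg Ideal.span Set.image_singleton)
  ext b
  rw [SetLike.mem_coe, ← hmap, Ideal.mem_map_iff_of_surjective _ reductionMap_surjective]
  simp only [torsionCode, Set.mem_ofPred_eq, h]

theorem torsionCode_span_prod {ι : Type*} [Fintype ι] {f : ι → R[X]} {M : ℕ}
    (hcop : Pairwise (Function.onFun IsCoprime f))
    (hM : (∏ l, ConstaRing.mk N lam (f l)) ^ M = 0)
    (hmax : ∀ l, (Ideal.span {ConstaRing.mk N lam (f l)}).IsMaximal)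
    (hstrict : ∀ l, ¬ ConstaRing.mk N lam (f l) ^ M ∣ ConstaRing.mk N lam (f l) ^ (M - 1))
    {u : (ConstaRing R N lam)ˣ}
    (hu : (∏ l, ConstaRing.mk N lam (f l)) ^ q = ConstaRing.mk N lam (C γ) * u)
    {k : ι → ℕ} (hk : ∀ l, k l ≤ M) (i : ℕ) :
    torsionCode γ N lam (Ideal.span {ConstaRing.mk N lam (∏ l, f l ^ k l)}) i =
      (Ideal.span {ConstaRing.mk N (residueMap γ lam)
        (∏ l, (f l).map (residueMap γ) ^ (min ((i + 1) * q) (k l) - min (i * q) (k l)))} :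
        Set (ConstaRing (ResidueRing γ) N (residueMap γ lam))) := by
  have hcop' : Pairwise (Function.onFun IsCoprime fun l => ConstaRing.mk N lam (f l)) :=
    fun l l' h => (hcop h).map _
  have hcopK : Pairwise (Function.onFun IsCoprime fun l =>
      ConstaRing.mk N (residueMap γ lam) ((f l).map (residueMap γ))) :=
    fun l l' h => ((hcop h).map (mapRingHom (residueMap γ))).map _
  have hq : (∏ l, ConstaRing.mk N (residueMap γ lam) ((f l).map (residueMap γ))) ^ q = 0 := by
    have h := congrArg (reductionMap γ N lam) hu
    rw [map_mul, reductionMap_mk_C_self, zero_mul, map_pow, map_prod] at h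
    exact h
  have hcolon : ∀ g, ConstaRing.mk N lam (C (γ ^ i)) * g ∈
      Ideal.span {ConstaRing.mk N lam (∏ l, f l ^ k l)} ↔
      g ∈ Ideal.span {ConstaRing.mk N lam (∏ l, f l ^ (k l - i * q))} := fun g => by
    have h := mul_prod_pow_mem_span_iff hcop' hM hmax hstrict hk (fun _ => i * q) g
    rw [Finset.prod_pow, mul_comm i q, pow_mul, hu] at h
    simp only [map_prod, map_pow, mul_comm i q]
    -- Membership is unaffected by the unit `u ^ i` relating `γ^i` to `z^(iq)`.
    rw [← h, ← Ideal.unit_mul_mem_iff_mem _ (u ^ i).isUnit, Units.val_pow_eq_pow_val]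
    rw [show (u : ConstaRing R N lam) ^ i * (ConstaRing.mk N lam (C γ) ^ i * g) =
      g * (ConstaRing.mk N lam (C γ) * u) ^ i by ring]
  rw [torsionCode_eq_of_mul_mem_iff hcolon]
  have hexp : ∀ l, min ((i + 1) * q) (k l) - min (i * q) (k l) = min q (k l - i * q) := fun l => by
    rw [add_mul, one_mul]
    omega
  simp only [hexp, Polynomial.map_prod, Polynomial.map_pow, map_prod, map_pow]
  rw [span_prod_pow_min hcopK hq]

end TorsionCode

theorem theorem2p6 {R : Type*} [CommRing R] (hR : IsFiniteChainRing R)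
    (γ : R) (hγ : (Ideal.span {γ} : Ideal R).IsMaximal)
    (e : ℕ) (he : e = nilpotencyClass γ)
    (p m : ℕ) (hp : p.Prime) (hm : 0 < m) (hcard : Nat.card (ResidueRing γ) = p ^ m)
    (ζ : R) (hζ : orderOf ζ = p ^ m - 1)
    (α β lam : R) (hα : α ∈ teichmullerSet ζ (p ^ m)) (hα0 : α ≠ 0) (hβ : IsUnit β)
    (hlam : lam = α + γ * β)
    (n s : ℕ) (hn : n.Coprime p) :
    (∃ α₀ ∈ teichmullerSet ζ (p ^ m), α₀ ^ p ^ s = α) ∧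
    ∀ α₀ ∈ teichmullerSet ζ (p ^ m), α₀ ^ p ^ s = α →
      (∃ (r : ℕ) (f : Fin r → R[X]), IsBasicFactorization γ (X ^ n - C α₀) f) ∧
      ∀ (r : ℕ) (f : Fin r → R[X]), IsBasicFactorization γ (X ^ n - C α₀) f →
        ∀ D : Ideal (ConstaRing R (n * p ^ s) lam),
          (∃ k : Fin r → ℕ, (∀ l, k l ≤ e * p ^ s) ∧
            D = Ideal.span {ConstaRing.mk (n * p ^ s) lam (∏ l, f l ^ k l)}) ∧
          ∀ k : Fin r → ℕ, (∀ l, k l ≤ e * p ^ s) →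
            D = Ideal.span {ConstaRing.mk (n * p ^ s) lam (∏ l, f l ^ k l)} →
            ∀ i < e,
              torsionCode γ (n * p ^ s) lam D i =
                (Ideal.span {ConstaRing.mk (n * p ^ s) (residueMap γ lam)
                  (∏ l, (f l).map (residueMap γ) ^
                    (min ((i + 1) * p ^ s) (k l) - min (i * p ^ s) (k l)))} :
                  Set (ConstaRing (ResidueRing γ) (n * p ^ s) (residueMap γ lam))) := by
  have hnil := hR.isNilpotent hγ
  have hpγ := exists_natCast_eq_mul hγ hcard
  have hq : 1 < p ^ m := Nat.one_lt_pow hm.ne' hp.one_lt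
  have hζ1 : ζ ^ (p ^ m - 1) = 1 := hζ ▸ pow_orderOf_eq_one ζ
  refine ⟨exists_teichmuller_root hq hζ1 s hα hα0 hm, fun α₀ hα₀ hpow => ?_⟩
  have hps : 0 < p ^ s := pow_pos hp.pos s
  have hα₀unit : IsUnit α₀ := isUnit_of_mem_teichmullerSet hq hζ1 hα₀ (by
    rintro rfl
    exact hα0 (by rw [← hpow, zero_pow hps.ne']))
  refine ⟨exists_isBasicFactorization hγ hnil hp hcard hn hα₀unit, fun r f hf D => ?_⟩
  have := hR.nontrivial
  have hn0 : 0 < n := Nat.pos_of_ne_zero (by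
    rintro rfl
    exact hp.one_lt.ne' (by simpa using hn))
  have hlam' : lam = α₀ ^ p ^ s + γ * β := by rw [hpow, hlam]
  have he0 : 0 < e := he ▸ pos_nilpotencyClass_iff.2 hnil
  have hγe : γ ^ e = 0 := he ▸ pow_nilpotencyClass hnil
  have hγe' : γ ^ (e - 1) ≠ 0 := he ▸ pow_pred_nilpotencyClass hnil
  obtain ⟨u, hu⟩ := ConstaRing.mk_pow_eq (n := n) hp hpγ hnil hβ hlam'
  rw [hf.prod_eq, map_prod] at hu
  have hM : (∏ l, ConstaRing.mk (n * p ^ s) lam (f l)) ^ (e * p ^ s) = 0 := by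
    rw [mul_comm e, pow_mul, hu, mul_pow, ← map_pow, ← C_pow, hγe, C_0, map_zero, zero_mul]
  have hcop : Pairwise (Function.onFun IsCoprime f) := fun l l' h => hf.coprime l l' h
  have hcop' : Pairwise (Function.onFun IsCoprime fun l =>
      ConstaRing.mk (n * p ^ s) lam (f l)) := fun l l' h => (hcop h).map _
  have hmax : ∀ l, (Ideal.span {ConstaRing.mk (n * p ^ s) lam (f l)}).IsMaximal := fun l =>
    ConstaRing.isMaximal_span_mk hγ hp hpγ hnil hβ hlam' (hf.basicIrreducible l)
      (hf.prod_eq ▸ Finset.dvd_prod_of_mem f (Finset.mem_univ l))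
  constructor
  · obtain ⟨k, hk, hD⟩ := exists_eq_span_prod_pow hcop' hM hmax D
    refine ⟨k, hk, ?_⟩
    simpa only [map_prod, map_pow] using hD
  · rintro k hk rfl i -
    refine torsionCode_span_prod hcop hM hmax (fun l => ?_) hu hk i
    let : Field (ResidueRing γ) := Ideal.Quotient.field _
    refine ConstaRing.not_pow_dvd_pow_pred hp hpγ hn0 hβ hlam' he0 hγe hγe' (hf.monic l)
      (monic_prod_of_monic (Finset.univ.erase l) f fun x _ => hf.monic x) ?_
      (hf.prod_eq.trans (Finset.mul_prod_erase _ f (Finset.mem_univ l)).symm)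
    rw [← (hf.monic l).natDegree_map (residueMap γ)]
    exact (hf.basicIrreducible l).natDegree_pos
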